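/- Let $M\subset\mathbf R^s$ be a compact $m$-dimensional $C^\infty$ submanifold without boundary. For $x\in\mathbf R^s$ let $L_x(\mu)=\|\mu-x\|^2$ and $\pi(x)=\operatorname{arg\,min}_{\mu\in M}L_x(\mu)$ (the nearest-point projection). Let the cutlocus $C$ be the set of all $x\in\mathbf R^s$ such that either the point of $M$ nearest to $x$ is not uniquely defined, or the restriction of $L_x$ to $M$ has a degenerate second derivative (Hessian) at $\mu=\pi(x)$. Write $d(t,A)$ for the Euclidean distance from $t$ to a set $A$, and $\|\cdot\|$ for the operator norm of linear maps. Lemma 3.1. Let $t\in\mathbf R^s\setminus C$. Then $d(t,C)>0$ if $C\neq\emptyset$, $\pi$ is differentiable at $t$, and $$\|\pi'(t)\|\le\frac{d(t,M)}{d(t,C)}+1,$$ where the quotient is read as $0$ if $C=\emptyset$. The inequality is sharp for spheres: if $m\ge 1$ and $M=S^m=\{x\in\mathbf R^{m+1}:\|x\|=1\}$, then for every $t\notin C$ in the closed unit ball of $\mathbf R^{m+1}$, $\pi$ is differentiable at $t$ and $$\|\pi'(t)\|=\frac{d(t,M)}{d(t,C)}+1.$$ -/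

import Mathlib

open scoped ContDiff

section NearestPoint

variable {E : Type*} [NormedAddCommGroup E] [InnerProductSpace ℝ E]

/-- A smooth slice chart for the set `M` modelled on the linear subspace `V`: a `C^∞` diffeomorphism
`Φ` between open sets of the ambient space such that, for `x ∈ Φ.source`,
`x ∈ M` if and only if `Φ x ∈ V`. -/
structure IsSliceChart (M : Set E) (V : Submodule ℝ E) (Φ : OpenPartialHomeomorph E E) : Prop where
  contDiffOn : ContDiffOn ℝ ∞ Φ Φ.source
  contDiffOn_symm : ContDiffOn ℝ ∞ Φ.symm Φ.target
  isImage : Φ.IsImage M (V : Set E)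

/-- `M` is an (embedded) smooth submanifold of `E`, without boundary, of dimension `m`: around each
of its points there is a slice chart modelled on a linear subspace of dimension `m`. -/
def IsSmoothSubmanifold (m : ℕ) (M : Set E) : Prop :=
  ∀ p ∈ M, ∃ (V : Submodule ℝ E) (Φ : OpenPartialHomeomorph E E),
    Module.finrank ℝ V = m ∧ p ∈ Φ.source ∧ IsSliceChart M V Φ

/-- The squared distance function `L_x(μ) = ‖μ - x‖ ^ 2`. -/
def sqDistTo (x μ : E) : ℝ := ‖μ - x‖ ^ 2

/-- `μ` is a point of `M` nearest to `x`, i.e. a minimizer of `L_x` on `M`. -/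
def IsNearestPoint (M : Set E) (x μ : E) : Prop :=
  μ ∈ M ∧ ∀ z ∈ M, sqDistTo x μ ≤ sqDistTo x z

/-- The second derivative at `μ` of the restriction of `L_x` to `M` is degenerate: computed in a
slice chart `Φ` around `μ` (so that `V ∋ y ↦ Φ.symm y` parametrizes `M` near `μ`), the symmetric
bilinear form `D²(L_x ∘ Φ.symm)(Φ μ)` on `V` has a nonzero vector in its kernel.
At a critical point of the restriction of `L_x` to `M` (in particular, at a minimizer)
this does not depend on the choice of the slice chart. -/
def DegenerateHessianAt (M : Set E) (x μ : E) : Prop :=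
  ∃ (V : Submodule ℝ E) (Φ : OpenPartialHomeomorph E E),
    IsSliceChart M V Φ ∧ μ ∈ Φ.source ∧
      ∃ v ∈ V, v ≠ 0 ∧
        ∀ w ∈ V, fderiv ℝ (fderiv ℝ (fun y => sqDistTo x (Φ.symm y))) (Φ μ) v w = 0

/-- The cutlocus of `M`: the points `x` for which the nearest point of `M` is not uniquely
defined, or `L_x` restricted to `M` has a degenerate second derivative at the nearest point. -/
def cutLocus (M : Set E) : Set E :=
  {x | (¬ ∃! μ, IsNearestPoint M x μ) ∨ ∃ μ, IsNearestPoint M x μ ∧ DegenerateHessianAt M x μ}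

open Classical in
/-- The nearest-point projection `π` onto `M`, as a map into the ambient space. Where there is no
nearest point its value is irrelevant (set to `0`); off the cutlocus it is the unique nearest
point. -/
noncomputable def nearestPointMap (M : Set E) (x : E) : E :=
  if h : ∃ μ, IsNearestPoint M x μ then h.choose else 0

end NearestPoint

open scoped ContDiff Topology RealInnerProductSpace
open Filter Set

section Calculus

variable {E F : Type*} [NormedAddCommGroup E] [NormedSpace ℝ E]
  [NormedAddCommGroup F] [NormedSpace ℝ F]

/-- If `h` maps `V` into the closed subspace `W` near `y ∈ V`, then so does its derivative
at `y`. -/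
theorem fderiv_apply_mem_of_eventually_mem {V : Submodule ℝ E} {W : Submodule ℝ F}
    (hW : IsClosed (W : Set F)) {h : E → F} {y v : E} (hd : DifferentiableAt ℝ h y)
    (hmem : ∀ᶠ z in 𝓝 y, z ∈ V → h z ∈ W) (hy : y ∈ V) (hv : v ∈ V) : fderiv ℝ h y v ∈ W := by
  have hline : HasDerivAt (fun s : ℝ => y + s • v) v 0 := by
    simpa using ((hasDerivAt_id (0 : ℝ)).smul_const v).const_add y
  have hd' : HasFDerivAt h (fderiv ℝ h y) (y + (0 : ℝ) • v) := by simpa using hd.hasFDerivAt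
  have hslope := (hd'.comp_hasDerivAt (0 : ℝ) hline).tendsto_slope
  have htend : Tendsto (fun s : ℝ => y + s • v) (𝓝[≠] 0) (𝓝 y) := by
    have := hline.continuousAt.tendsto
    rw [zero_smul, add_zero] at this
    exact this.mono_left nhdsWithin_le_nhds
  refine hW.mem_of_tendsto hslope ?_
  filter_upwards [htend.eventually hmem] with s hs
  rw [slope_def_module]
  refine W.smul_mem _ (W.sub_mem (hs (V.add_mem hy (V.smul_mem s hv))) ?_)
  simpa using hmem.self_of_nhds hy

/-- Two functions which agree on `V` near `y ∈ V` have the same derivative at `y` along `V`. -/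
theorem fderiv_apply_eq_of_eventually_eq {V : Submodule ℝ E} {f g : E → F} {y v : E}
    (hf : DifferentiableAt ℝ f y) (hg : DifferentiableAt ℝ g y)
    (h : ∀ᶠ z in 𝓝 y, z ∈ V → f z = g z) (hy : y ∈ V) (hv : v ∈ V) :
    fderiv ℝ f y v = fderiv ℝ g y v := by
  have := fderiv_apply_mem_of_eventually_mem (V := V) (W := ⊥) (h := fun z => f z - g z)
    (by simp) (hf.sub hg)
    (h.mono fun z hz hzV => by simp [hz hzV]) hy hv
  rw [fderiv_fun_sub hf hg, Submodule.mem_bot] at this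
  exact sub_eq_zero.1 (by simpa using this)

end Calculus

section Charts

variable {E : Type*} [NormedAddCommGroup E] [InnerProductSpace ℝ E]

theorem contDiffAt_uncurry_sqDistTo {M : Set E} {V : Submodule ℝ E} {Φ : OpenPartialHomeomorph E E}
    (hΦ : IsSliceChart M V Φ) (x : E) {y : E} (hy : y ∈ Φ.target) :
    ContDiffAt ℝ ∞ (Function.uncurry fun x y => sqDistTo x (Φ.symm y)) (x, y) := by
  have h1 : ContDiffAt ℝ ∞ Φ.symm y :=
    hΦ.contDiffOn_symm.contDiffAt (Φ.open_target.mem_nhds hy)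
  have h2 : ContDiffAt ℝ ∞ (fun p : E × E => Φ.symm p.2) (x, y) :=
    ContDiffAt.comp (g := Φ.symm) (x, y) h1 contDiffAt_snd
  exact (h2.sub contDiffAt_fst).norm_sq ℝ

theorem contDiffAt_sqDistTo {M : Set E} {V : Submodule ℝ E} {Φ : OpenPartialHomeomorph E E}
    (hΦ : IsSliceChart M V Φ) (x : E) {y : E} (hy : y ∈ Φ.target) :
    ContDiffAt ℝ ∞ (fun y => sqDistTo x (Φ.symm y)) y :=
  (contDiffAt_uncurry_sqDistTo hΦ x hy).comp y (contDiffAt_const.prodMk contDiffAt_id)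

theorem contDiffAt_fderiv_sqDistTo {M : Set E} {V : Submodule ℝ E}
    {Φ : OpenPartialHomeomorph E E} (hΦ : IsSliceChart M V Φ) (x : E) {y : E}
    (hy : y ∈ Φ.target) :
    ContDiffAt ℝ ∞ (fun p : E × E => fderiv ℝ (fun y => sqDistTo p.1 (Φ.symm y)) p.2) (x, y) := by
  refine ContDiffAt.fderiv (n := ∞) (f := fun (p : E × E) y => sqDistTo p.1 (Φ.symm y))
    ?_ contDiffAt_snd (by simp)
  exact (contDiffAt_uncurry_sqDistTo hΦ x hy).comp ((x, y), y)
    ((contDiffAt_fst.comp _ contDiffAt_fst).prodMk contDiffAt_snd)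

theorem continuousAt_fderiv_fderiv_sqDistTo {M : Set E} {V : Submodule ℝ E}
    {Φ : OpenPartialHomeomorph E E} (hΦ : IsSliceChart M V Φ) (x : E) {y : E}
    (hy : y ∈ Φ.target) :
    ContinuousAt
      (fun p : E × E => fderiv ℝ (fderiv ℝ fun y => sqDistTo p.1 (Φ.symm y)) p.2) (x, y) := by
  refine (ContDiffAt.fderiv (m := 0) (n := ∞)
    (f := fun (p : E × E) => fderiv ℝ fun y => sqDistTo p.1 (Φ.symm y))
    ?_ contDiffAt_snd (by simp)).continuousAt
  exact (contDiffAt_fderiv_sqDistTo hΦ x hy).comp ((x, y), y)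
    ((contDiffAt_fst.comp _ contDiffAt_fst).prodMk contDiffAt_snd)

theorem fderiv_sqDistTo_apply {M : Set E} {V : Submodule ℝ E} {Φ : OpenPartialHomeomorph E E}
    (hΦ : IsSliceChart M V Φ) (x : E) {y : E} (hy : y ∈ Φ.target) (w : E) :
    fderiv ℝ (fun y => sqDistTo x (Φ.symm y)) y w =
      2 * ⟪Φ.symm y - x, fderiv ℝ Φ.symm y w⟫ := by
  have h1 : HasFDerivAt Φ.symm (fderiv ℝ Φ.symm y) y :=
    ((hΦ.contDiffOn_symm.contDiffAt (Φ.open_target.mem_nhds hy)).differentiableAt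
      (by simp)).hasFDerivAt
  have h2 := (h1.sub_const x).norm_sq
  have h3 : fderiv ℝ (fun y => sqDistTo x (Φ.symm y)) y = _ := h2.fderiv
  rw [h3]
  simp [inner_sub_left]

/-- A nearest point of `M` to `x` is a critical point of the restriction of `L_x` to `M`. -/
theorem IsNearestPoint.fderiv_eq_zero {M : Set E} {V : Submodule ℝ E}
    {Φ : OpenPartialHomeomorph E E} (hΦ : IsSliceChart M V Φ) {x μ : E}
    (h : IsNearestPoint M x μ) (hμ : μ ∈ Φ.source) {w : E} (hw : w ∈ V) :
    fderiv ℝ (fun y => sqDistTo x (Φ.symm y)) (Φ μ) w = 0 := by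
  have hy : Φ μ ∈ Φ.target := Φ.map_source hμ
  have hyV : Φ μ ∈ V := (hΦ.isImage hμ).2 h.1
  have hd : HasFDerivAt (fun y => sqDistTo x (Φ.symm y))
      (fderiv ℝ (fun y => sqDistTo x (Φ.symm y)) (Φ μ)) (Φ μ + (0 : ℝ) • w) := by
    simpa using ((contDiffAt_sqDistTo hΦ x hy).differentiableAt (by simp)).hasFDerivAt
  have hline : HasDerivAt (fun s : ℝ => Φ μ + s • w) w 0 := by
    simpa using ((hasDerivAt_id (0 : ℝ)).smul_const w).const_add (Φ μ)
  have htend : Tendsto (fun s : ℝ => Φ μ + s • w) (𝓝 0) (𝓝 (Φ μ)) := by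
    have := hline.continuousAt.tendsto
    rwa [zero_smul, add_zero] at this
  refine IsLocalMin.hasDerivAt_eq_zero ?_ (hd.comp_hasDerivAt (0 : ℝ) hline)
  filter_upwards [htend.eventually (Φ.open_target.mem_nhds hy)] with s hs
  simp only [Function.comp_apply, zero_smul, add_zero, Φ.left_inv hμ]
  exact h.2 _ ((hΦ.isImage.symm_apply_mem_iff hs).2 (V.add_mem hyV (V.smul_mem s hw)))

/-- The transition map between two slice charts maps the second model subspace into the first. -/
theorem IsSliceChart.fderiv_transition_mem [FiniteDimensional ℝ E] {M : Set E}
    {V₁ V₂ : Submodule ℝ E} {Φ₁ Φ₂ : OpenPartialHomeomorph E E} (h₁ : IsSliceChart M V₁ Φ₁)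
    (h₂ : IsSliceChart M V₂ Φ₂) {y w : E} (hy : y ∈ (Φ₂.symm.trans Φ₁).source) (hyV : y ∈ V₂)
    (hw : w ∈ V₂) : fderiv ℝ (Φ₂.symm.trans Φ₁) y w ∈ V₁ := by
  have hopen := (Φ₂.symm.trans Φ₁).open_source.mem_nhds hy
  refine fderiv_apply_mem_of_eventually_mem (V := V₂) V₁.closed_of_finiteDimensional ?_ ?_ hyV hw
  · simp only [OpenPartialHomeomorph.trans_source, OpenPartialHomeomorph.symm_source, mem_inter_iff,
      mem_preimage] at hy
    exact ((h₁.contDiffOn.contDiffAt (Φ₁.open_source.mem_nhds hy.2)).differentiableAt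
      (by simp)).comp y ((h₂.contDiffOn_symm.contDiffAt
        (Φ₂.open_target.mem_nhds hy.1)).differentiableAt (by simp))
  · filter_upwards [hopen] with z hz hzV
    simp only [OpenPartialHomeomorph.trans_source, OpenPartialHomeomorph.symm_source, mem_inter_iff,
      mem_preimage] at hz
    exact (h₁.isImage hz.2).2 ((h₂.isImage.symm_apply_mem_iff hz.1).2 hzV)

theorem IsSliceChart.contDiffAt_transition {M : Set E}
    {V₁ V₂ : Submodule ℝ E} {Φ₁ Φ₂ : OpenPartialHomeomorph E E} (h₁ : IsSliceChart M V₁ Φ₁)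
    (h₂ : IsSliceChart M V₂ Φ₂) {y : E} (hy : y ∈ (Φ₂.symm.trans Φ₁).source) :
    ContDiffAt ℝ ∞ (Φ₂.symm.trans Φ₁) y := by
  simp only [OpenPartialHomeomorph.trans_source, OpenPartialHomeomorph.symm_source, mem_inter_iff,
    mem_preimage] at hy
  exact (h₁.contDiffOn.contDiffAt (Φ₁.open_source.mem_nhds hy.2)).comp y
    (h₂.contDiffOn_symm.contDiffAt (Φ₂.open_target.mem_nhds hy.1))

theorem IsSliceChart.fderiv_transition_transition {M : Set E}
    {V₁ V₂ : Submodule ℝ E} {Φ₁ Φ₂ : OpenPartialHomeomorph E E} (h₁ : IsSliceChart M V₁ Φ₁)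
    (h₂ : IsSliceChart M V₂ Φ₂) {μ : E} (hμ₁ : μ ∈ Φ₁.source) (hμ₂ : μ ∈ Φ₂.source) (w : E) :
    fderiv ℝ (Φ₂.symm.trans Φ₁) (Φ₂ μ) (fderiv ℝ (Φ₁.symm.trans Φ₂) (Φ₁ μ) w) = w := by
  have hs₂ : Φ₂ μ ∈ (Φ₂.symm.trans Φ₁).source := by simp [hμ₁, hμ₂]
  have hs₁ : Φ₁ μ ∈ (Φ₁.symm.trans Φ₂).source := by simp [hμ₁, hμ₂]
  have hd₁ := ((h₂.contDiffAt_transition h₁ hs₁).differentiableAt (by simp)).hasFDerivAt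
  have hd₂ := ((h₁.contDiffAt_transition h₂ hs₂).differentiableAt (by simp)).hasFDerivAt
  have heq : (Φ₁.symm.trans Φ₂) (Φ₁ μ) = Φ₂ μ := by simp [hμ₁]
  rw [← heq] at hd₂
  have hcomp := hd₂.comp (Φ₁ μ) hd₁
  have hid : (Φ₂.symm.trans Φ₁) ∘ (Φ₁.symm.trans Φ₂) =ᶠ[𝓝 (Φ₁ μ)] id := by
    filter_upwards [(Φ₁.symm.trans Φ₂).open_source.mem_nhds hs₁] with z hz
    simp only [OpenPartialHomeomorph.trans_source, OpenPartialHomeomorph.symm_source, mem_inter_iff,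
      mem_preimage] at hz
    simp [Φ₂.left_inv hz.2, Φ₁.right_inv hz.1]
  have := (hcomp.congr_of_eventuallyEq hid.symm).unique (hasFDerivAt_id (Φ₁ μ))
  rw [heq] at this
  exact DFunLike.congr_fun this w

/-- At a nearest point, degeneracy of the Hessian can be tested in any slice chart. -/
theorem DegenerateHessianAt.exists_of_isSliceChart [FiniteDimensional ℝ E] {M : Set E}
    {V : Submodule ℝ E} {Φ : OpenPartialHomeomorph E E} (hΦ : IsSliceChart M V Φ) {x μ : E}
    (hmin : IsNearestPoint M x μ) (hμ : μ ∈ Φ.source) (hdeg : DegenerateHessianAt M x μ) :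
    ∃ v ∈ V, v ≠ 0 ∧
      ∀ w ∈ V, fderiv ℝ (fderiv ℝ fun y => sqDistTo x (Φ.symm y)) (Φ μ) v w = 0 := by
  obtain ⟨V₂, Φ₂, h₂, hμ₂, v, hv, hv0, hker⟩ := hdeg
  set τ := Φ₂.symm.trans Φ with hτ
  set f₁ := fun y => sqDistTo x (Φ.symm y) with hf₁
  set f₂ := fun y => sqDistTo x (Φ₂.symm y) with hf₂
  have hy₁ : Φ μ ∈ Φ.target := Φ.map_source hμ
  have hyV₁ : Φ μ ∈ V := (hΦ.isImage hμ).2 hmin.1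
  have hyV₂ : Φ₂ μ ∈ V₂ := (h₂.isImage hμ₂).2 hmin.1
  have hs₂ : Φ₂ μ ∈ τ.source := by simp [hτ, hμ, hμ₂]
  have hs₁ : Φ μ ∈ (Φ.symm.trans Φ₂).source := by simp [hμ, hμ₂]
  have hτμ : τ (Φ₂ μ) = Φ μ := by simp [hτ, hμ₂]
  have hτsm := hΦ.contDiffAt_transition h₂ hs₂
  have hf₁sm : ContDiffAt ℝ ∞ f₁ (τ (Φ₂ μ)) := hτμ ▸ contDiffAt_sqDistTo hΦ x hy₁
  have hdf : fderiv ℝ f₂ =ᶠ[𝓝 (Φ₂ μ)] fun y => (fderiv ℝ f₁ (τ y)).comp (fderiv ℝ τ y) := by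
    filter_upwards [τ.open_source.mem_nhds hs₂] with z hz
    have hz' := hz
    simp only [hτ, OpenPartialHomeomorph.trans_source, OpenPartialHomeomorph.symm_source,
      mem_inter_iff, mem_preimage] at hz'
    have heq : f₂ =ᶠ[𝓝 z] f₁ ∘ τ := by
      filter_upwards [τ.open_source.mem_nhds hz] with u hu
      simp only [hτ, OpenPartialHomeomorph.trans_source, OpenPartialHomeomorph.symm_source,
        mem_inter_iff, mem_preimage] at hu
      simp [hf₁, hf₂, hτ, Φ.left_inv hu.2]
    rw [heq.fderiv_eq]
    refine fderiv_comp z ?_ ((hΦ.contDiffAt_transition h₂ hz).differentiableAt (by simp))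
    exact (contDiffAt_sqDistTo hΦ x (Φ.map_source hz'.2)).differentiableAt (by simp)
  have hd₁ : HasFDerivAt (fun y => fderiv ℝ f₁ (τ y))
      ((fderiv ℝ (fderiv ℝ f₁) (τ (Φ₂ μ))).comp (fderiv ℝ τ (Φ₂ μ))) (Φ₂ μ) :=
    (((hf₁sm.fderiv_right (m := ∞) (by simp)).differentiableAt
      (by simp)).hasFDerivAt).comp (Φ₂ μ) (hτsm.differentiableAt (by simp)).hasFDerivAt
  have hdτ : HasFDerivAt (fderiv ℝ τ) (fderiv ℝ (fderiv ℝ τ) (Φ₂ μ)) (Φ₂ μ) :=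
    ((hτsm.fderiv_right (m := ∞) (by simp)).differentiableAt (by simp)).hasFDerivAt
  have hformula : ∀ a b, fderiv ℝ (fderiv ℝ f₂) (Φ₂ μ) a b =
      fderiv ℝ f₁ (Φ μ) (fderiv ℝ (fderiv ℝ τ) (Φ₂ μ) a b) +
      fderiv ℝ (fderiv ℝ f₁) (Φ μ) (fderiv ℝ τ (Φ₂ μ) a) (fderiv ℝ τ (Φ₂ μ) b) := by
    intro a b
    rw [hdf.fderiv_eq, (hd₁.clm_comp hdτ).fderiv]
    simp [hτμ]
  have hsecond : ∀ a ∈ V₂, ∀ b ∈ V₂, fderiv ℝ (fderiv ℝ τ) (Φ₂ μ) a b ∈ V := by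
    intro a ha b hb
    have := fderiv_apply_mem_of_eventually_mem (V := V₂) (W := V) (y := Φ₂ μ) (v := a)
      (h := fun y => fderiv ℝ τ y b) V.closed_of_finiteDimensional
      (hdτ.differentiableAt.clm_apply (differentiableAt_const b)) ?_ hyV₂ ha
    · rwa [fderiv_clm_apply hdτ.differentiableAt (differentiableAt_const b), fderiv_fun_const,
        show ((fderiv ℝ τ (Φ₂ μ)).comp ((0 : E → E →L[ℝ] E) (Φ₂ μ)) +
          (fderiv ℝ (fderiv ℝ τ) (Φ₂ μ)).flip b) a = fderiv ℝ (fderiv ℝ τ) (Φ₂ μ) a b by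
          simp] at this
    · filter_upwards [τ.open_source.mem_nhds hs₂] with z hz hzV
      exact hΦ.fderiv_transition_mem h₂ hz hzV hb
  refine ⟨fderiv ℝ τ (Φ₂ μ) v, hΦ.fderiv_transition_mem h₂ hs₂ hyV₂ hv, ?_, ?_⟩
  · intro h0
    have := h₂.fderiv_transition_transition hΦ hμ₂ hμ v
    rw [← hτ, h0, map_zero] at this
    exact hv0 this.symm
  · intro w hw
    have hw₂ := h₂.fderiv_transition_mem hΦ hs₁ hyV₁ hw
    have h := hker _ hw₂
    rw [hformula, hmin.fderiv_eq_zero hΦ hμ (hsecond v hv _ hw₂), zero_add, hτ,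
      hΦ.fderiv_transition_transition h₂ hμ hμ₂ w] at h
    exact h

end Charts

section ImplicitFunction

variable {E : Type*} [NormedAddCommGroup E] [InnerProductSpace ℝ E]

/-- A nondegenerate bilinear form on a finite-dimensional space is invertible as a map to the
dual. -/
theorem isInvertible_of_forall_eq_zero {V : Type*} [NormedAddCommGroup V] [InnerProductSpace ℝ V]
    [FiniteDimensional ℝ V] (L : V →L[ℝ] V →L[ℝ] ℝ) (h : ∀ v, (∀ w, L v w = 0) → v = 0) :
    L.IsInvertible := by
  have : FiniteDimensional ℝ (V →L[ℝ] ℝ) :=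
    (InnerProductSpace.toDual ℝ V).toLinearEquiv.finiteDimensional
  have hinj : Function.Injective (L : V →ₗ[ℝ] V →L[ℝ] ℝ) := by
    rw [← LinearMap.ker_eq_bot, LinearMap.ker_eq_bot']
    intro v hv
    exact h v fun w => by
      have := DFunLike.congr_fun hv w
      simpa using this
  have hdim : Module.finrank ℝ V = Module.finrank ℝ (V →L[ℝ] ℝ) :=
    (InnerProductSpace.toDual ℝ V).toLinearEquiv.finrank_eq
  exact ⟨(LinearMap.linearEquivOfInjective _ hinj hdim).toContinuousLinearEquiv, by
    ext v w; rfl⟩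

/-- Restriction of continuous linear functionals to a subspace. -/
noncomputable def restrictDual (V : Submodule ℝ E) : (E →L[ℝ] ℝ) →L[ℝ] V →L[ℝ] ℝ :=
  (ContinuousLinearMap.compL ℝ V E ℝ).flip V.subtypeL

/-- The second derivative at `y` of `L_x` read in the chart `Φ`, as a bilinear form on `V`. -/
noncomputable def chartHessian (V : Submodule ℝ E) (Φ : OpenPartialHomeomorph E E) (x y : E) :
    V →L[ℝ] V →L[ℝ] ℝ :=
  (restrictDual V).comp
    ((fderiv ℝ (fderiv ℝ fun y => sqDistTo x (Φ.symm y)) y).comp V.subtypeL)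

theorem chartHessian_apply (V : Submodule ℝ E) (Φ : OpenPartialHomeomorph E E) (x y : E)
    (v w : V) : chartHessian V Φ x y v w =
      fderiv ℝ (fderiv ℝ fun y => sqDistTo x (Φ.symm y)) y v w := rfl

variable [FiniteDimensional ℝ E]

theorem isInvertible_chartHessian {M : Set E} {V : Submodule ℝ E}
    {Φ : OpenPartialHomeomorph E E} (hΦ : IsSliceChart M V Φ) {x μ : E} (hμ : μ ∈ Φ.source)
    (hnd : ¬ DegenerateHessianAt M x μ) : (chartHessian V Φ x (Φ μ)).IsInvertible := by
  refine isInvertible_of_forall_eq_zero _ fun v hv => ?_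
  by_contra hv0
  exact hnd ⟨V, Φ, hΦ, hμ, v, v.2, by simpa using hv0, fun w hw => hv ⟨w, hw⟩⟩

/-- Nondegeneracy of the Hessian at a nearest point is an open condition. -/
theorem eventually_not_degenerateHessianAt {M : Set E} {V : Submodule ℝ E}
    {Φ : OpenPartialHomeomorph E E} (hΦ : IsSliceChart M V Φ) {t μ : E} (hμ : μ ∈ Φ.source)
    (hnd : ¬ DegenerateHessianAt M t μ) :
    ∀ᶠ p : E × E in 𝓝 (t, μ), IsNearestPoint M p.1 p.2 → ¬ DegenerateHessianAt M p.1 p.2 := by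
  obtain ⟨e, he⟩ := isInvertible_chartHessian hΦ hμ hnd
  have hcont : ContinuousAt (fun p : E × E => chartHessian V Φ p.1 p.2) (t, Φ μ) :=
    continuousAt_const.clm_comp ((continuousAt_fderiv_fderiv_sqDistTo hΦ t
      (Φ.map_source hμ)).clm_comp continuousAt_const)
  have hcont' : ContinuousAt (fun p : E × E => chartHessian V Φ p.1 (Φ p.2)) (t, μ) :=
    ContinuousAt.comp (f := fun p : E × E => (p.1, Φ p.2))
      (g := fun p : E × E => chartHessian V Φ p.1 p.2) hcont
      (continuousAt_fst.prodMk ((Φ.continuousAt hμ).comp continuousAt_snd))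
  have hnhds : range ((↑) : (V ≃L[ℝ] V →L[ℝ] ℝ) → V →L[ℝ] V →L[ℝ] ℝ) ∈
      𝓝 (chartHessian V Φ t (Φ μ)) := he ▸ ContinuousLinearEquiv.nhds (𝕜 := ℝ) (E := V) (F := V →L[ℝ] ℝ) e
  have hsrc : ∀ᶠ p : E × E in 𝓝 (t, μ), p.2 ∈ Φ.source :=
    continuousAt_snd.eventually (Φ.open_source.mem_nhds hμ)
  filter_upwards [hcont'.eventually hnhds, hsrc] with p hp hps hmin hdeg
  obtain ⟨e', he'⟩ := hp
  obtain ⟨v, hv, hv0, hker⟩ := hdeg.exists_of_isSliceChart hΦ hmin hps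
  have : e' ⟨v, hv⟩ = 0 := by
    ext w
    have h1 : (e' : V →L[ℝ] V →L[ℝ] ℝ) ⟨v, hv⟩ w = 0 := by
      rw [he', chartHessian_apply]
      exact hker w w.2
    exact h1
  rw [map_eq_zero_iff e' e'.injective] at this
  exact hv0 (congrArg Subtype.val this)

/-- Near a nondegenerate nearest point `μ` of `t`, the critical points of the restrictions of
`L_x` to `M`, for `x` near `t`, are given by a function of `x` which is differentiable at `t`. -/
theorem exists_critical_point_function {M : Set E} {V : Submodule ℝ E}
    {Φ : OpenPartialHomeomorph E E} (hΦ : IsSliceChart M V Φ) {t μ : E} (hμ : μ ∈ Φ.source)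
    (hmin : IsNearestPoint M t μ) (hnd : ¬ DegenerateHessianAt M t μ) :
    ∃ ψ : E → E, DifferentiableAt ℝ ψ t ∧ ∀ᶠ p : E × E in 𝓝 (t, μ), p.2 ∈ M →
      (∀ w ∈ V, fderiv ℝ (fun y => sqDistTo p.1 (Φ.symm y)) (Φ p.2) w = 0) → p.2 = ψ p.1 := by
  have hyV : Φ μ ∈ V := (hΦ.isImage hμ).2 hmin.1
  have hy : Φ μ ∈ Φ.target := Φ.map_source hμ
  set y₀ : V := ⟨Φ μ, hyV⟩ with hy₀
  set G : E × E → E →L[ℝ] ℝ := fun p => fderiv ℝ (fun y => sqDistTo p.1 (Φ.symm y)) p.2 with hG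
  set F : E × V → V →L[ℝ] ℝ := fun p => restrictDual V (G (p.1, p.2)) with hF
  have hGsm : ContDiffAt ℝ ∞ G (t, Φ μ) := contDiffAt_fderiv_sqDistTo hΦ t hy
  have hFsm : ContDiffAt ℝ ∞ F (t, y₀) := by
    refine (ContinuousLinearMap.contDiff (𝕜 := ℝ) (E := E →L[ℝ] ℝ) (F := V →L[ℝ] ℝ)
      (restrictDual V)).contDiffAt.comp (t, y₀) ?_
    refine ContDiffAt.comp (g := G) (t, y₀) hGsm ?_
    exact contDiffAt_fst.prodMk (V.subtypeL.contDiff.contDiffAt.comp _ contDiffAt_snd)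
  have hstrict := hFsm.hasStrictFDerivAt (by simp)
  have hinr : (fderiv ℝ F (t, y₀)).comp (.inr ℝ E V) = chartHessian V Φ t (Φ μ) := by
    have h1 : HasFDerivAt (fun y : V => F (t, y)) ((fderiv ℝ F (t, y₀)).comp (.inr ℝ E V)) y₀ :=
      HasFDerivAt.comp (f := fun y : V => (t, y)) y₀ hstrict.hasFDerivAt
        (hasFDerivAt_prodMk_right t y₀)
    have h2 : HasFDerivAt (fderiv ℝ fun y => sqDistTo t (Φ.symm y))
        (fderiv ℝ (fderiv ℝ fun y => sqDistTo t (Φ.symm y)) (Φ μ)) (V.subtypeL y₀) :=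
      (((contDiffAt_sqDistTo hΦ t hy).fderiv_right (m := ∞) (by simp)).differentiableAt
        (by simp)).hasFDerivAt
    have h3 := h2.comp y₀ V.subtypeL.hasFDerivAt
    have h4 : HasFDerivAt (restrictDual V) (restrictDual V)
        (((fderiv ℝ fun y => sqDistTo t (Φ.symm y)) ∘ V.subtypeL) y₀) :=
      ContinuousLinearMap.hasFDerivAt (𝕜 := ℝ) (E := E →L[ℝ] ℝ) (F := V →L[ℝ] ℝ) (restrictDual V)
    have h5 : HasFDerivAt (fun y : V => F (t, y)) (chartHessian V Φ t (Φ μ)) y₀ :=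
      HasFDerivAt.comp (g := restrictDual V) y₀ h4 h3
    exact h1.unique h5
  have hinv : ((fderiv ℝ F (t, y₀)).comp (.inr ℝ E V)).IsInvertible :=
    hinr ▸ isInvertible_chartHessian hΦ hμ hnd
  have hF0 : F (t, y₀) = 0 := by
    ext w
    exact hmin.fderiv_eq_zero hΦ hμ w.2
  set φ := hstrict.implicitFunctionOfProdDomain hinv with hφ
  have hφd : DifferentiableAt ℝ φ t :=
    (hstrict.hasStrictFDerivAt_implicitFunctionOfProdDomain hinv).hasFDerivAt.differentiableAt
  have hiff := hstrict.eventually_apply_eq_iff_implicitFunctionOfProdDomain hinv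
  have hφt : φ t = y₀ := hiff.self_of_nhds.1 rfl
  refine ⟨fun x => Φ.symm (φ x), ?_, ?_⟩
  · have hsm : DifferentiableAt ℝ Φ.symm (φ t) := by
      rw [hφt]
      exact (hΦ.contDiffOn_symm.contDiffAt (Φ.open_target.mem_nhds hy)).differentiableAt (by simp)
    exact DifferentiableAt.comp (g := Φ.symm) t hsm
      (V.subtypeL.differentiableAt.comp t hφd)
  · rw [nhds_prod_eq] at hiff
    obtain ⟨A, hA, B, hB, hAB⟩ := Filter.eventually_prod_iff.1 hiff
    rw [nhds_subtype_eq_comap, eventually_comap] at hB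
    have hsrc : ∀ᶠ p : E × E in 𝓝 (t, μ), p.2 ∈ Φ.source :=
      continuousAt_snd.eventually (Φ.open_source.mem_nhds hμ)
    have hA' : ∀ᶠ p : E × E in 𝓝 (t, μ), A p.1 := continuousAt_fst.eventually hA
    have hB' : ∀ᶠ p : E × E in 𝓝 (t, μ), ∀ a : V, (a : E) = Φ p.2 → B a :=
      ((Φ.continuousAt hμ).comp (x := (t, μ)) continuousAt_snd).eventually hB
    filter_upwards [hsrc, hA', hB'] with p hps hpA hpB hpM hcrit
    have hpV : Φ p.2 ∈ V := (hΦ.isImage hps).2 hpM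
    have h := (hAB hpA (hpB ⟨Φ p.2, hpV⟩ rfl)).1 (by
      rw [hF0]
      ext w
      exact hcrit w w.2)
    have h' : φ p.1 = ⟨Φ p.2, hpV⟩ := h
    simp [h', Φ.left_inv hps]

end ImplicitFunction

section CutLocus

variable {E : Type*} [NormedAddCommGroup E] [InnerProductSpace ℝ E]

omit [InnerProductSpace ℝ E] in
theorem isNearestPoint_iff_norm {M : Set E} {x μ : E} :
    IsNearestPoint M x μ ↔ μ ∈ M ∧ ∀ z ∈ M, ‖μ - x‖ ≤ ‖z - x‖ := by
  simp only [IsNearestPoint, sqDistTo]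
  refine and_congr_right fun _ => forall₂_congr fun z _ => ?_
  exact pow_le_pow_iff_left₀ (norm_nonneg _) (norm_nonneg _) two_ne_zero

/-- Expansion of the nearest point condition for a point on the ray from `μ` through `x`. -/
theorem isNearestPoint_ray_iff {M : Set E} {x μ : E} {b : ℝ} :
    IsNearestPoint M (μ + b • (x - μ)) μ ↔
      μ ∈ M ∧ ∀ q ∈ M, 2 * b * ⟪x - μ, q - μ⟫ ≤ ‖q - μ‖ ^ 2 := by
  simp only [IsNearestPoint, sqDistTo]
  refine and_congr_right fun _ => forall₂_congr fun q _ => ?_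
  have h1 : μ - (μ + b • (x - μ)) = -(b • (x - μ)) := by abel
  have h2 : q - (μ + b • (x - μ)) = (q - μ) - b • (x - μ) := by abel
  rw [h1, h2, norm_neg, norm_sub_sq_real, inner_smul_right, real_inner_comm]
  constructor <;> intro h <;> linarith

omit [InnerProductSpace ℝ E] in
theorem IsCompact.exists_isNearestPoint {M : Set E} (hM : IsCompact M) (hne : M.Nonempty) (x : E) :
    ∃ μ, IsNearestPoint M x μ := by
  obtain ⟨μ, hμ, hmin⟩ := hM.exists_isMinOn hne (f := sqDistTo x)
    (by unfold sqDistTo; fun_prop)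
  exact ⟨μ, hμ, fun z hz => hmin hz⟩

omit [InnerProductSpace ℝ E] in
theorem IsNearestPoint.infDist_eq {M : Set E} {x μ : E} (h : IsNearestPoint M x μ) :
    Metric.infDist x M = ‖x - μ‖ := by
  obtain ⟨hμ, hmin⟩ := isNearestPoint_iff_norm.1 h
  refine le_antisymm ?_ ?_
  · rw [← dist_eq_norm]
    exact Metric.infDist_le_dist_of_mem hμ
  · refine (Metric.le_infDist ⟨μ, hμ⟩).2 fun z hz => ?_
    rw [dist_eq_norm, norm_sub_rev x μ, norm_sub_rev x z]
    exact hmin z hz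

omit [InnerProductSpace ℝ E] in
theorem nearestPointMap_spec {M : Set E} {x μ : E} (h : IsNearestPoint M x μ) :
    IsNearestPoint M x (nearestPointMap M x) := by
  have hex : ∃ μ, IsNearestPoint M x μ := ⟨μ, h⟩
  rw [nearestPointMap, dif_pos hex]
  exact hex.choose_spec

omit [InnerProductSpace ℝ E] in
/-- If `μ` is the only nearest point to `t`, then all nearest points to points near `t` are
near `μ`. -/
theorem IsCompact.eventually_isNearestPoint_mem {M : Set E} (hM : IsCompact M) {t μ : E}
    (hμ : IsNearestPoint M t μ) (huniq : ∀ z, IsNearestPoint M t z → z = μ) {N : Set E}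
    (hN : N ∈ 𝓝 μ) : ∀ᶠ x in 𝓝 t, ∀ z, IsNearestPoint M x z → z ∈ N := by
  have hK : IsCompact (M \ interior N) := hM.diff isOpen_interior
  have hlt : ∀ᶠ x in 𝓝 t, ∀ z ∈ M \ interior N, sqDistTo x μ < sqDistTo x z := by
    refine hK.eventually_forall_of_forall_eventually fun z hz => ?_
    have h0 : sqDistTo t μ < sqDistTo t z := by
      refine lt_of_le_of_ne (hμ.2 z hz.1) fun heq => ?_
      have := huniq z ⟨hz.1, fun w hw => heq ▸ hμ.2 w hw⟩
      exact hz.2 (this ▸ mem_interior_iff_mem_nhds.2 hN)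
    have hc1 : Continuous fun p : E × E => sqDistTo p.1 μ := by unfold sqDistTo; fun_prop
    have hc2 : Continuous fun p : E × E => sqDistTo p.1 p.2 := by unfold sqDistTo; fun_prop
    exact (isOpen_lt hc1 hc2).mem_nhds h0
  filter_upwards [hlt] with x hx z hz
  by_contra hzN
  exact absurd (hz.2 μ hμ.1) (not_le.2 (hx z ⟨hz.1, fun h => hzN (interior_subset h)⟩))

/-- Local structure off the cutlocus: near `t`, all points are off the cutlocus, the nearest point
is a function differentiable at `t`, and this function is constant on the normal ray through `t`. -/
theorem exists_local_projection [FiniteDimensional ℝ E] {m : ℕ} {M : Set E} (hM : IsCompact M)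
    (hsm : IsSmoothSubmanifold m M) {t μ : E} (ht : t ∉ cutLocus M) (hμ : IsNearestPoint M t μ) :
    ∃ ψ : E → E, DifferentiableAt ℝ ψ t ∧
      (∀ᶠ x in 𝓝 t, x ∉ cutLocus M ∧ ∀ z, IsNearestPoint M x z → z = ψ x) ∧
      ∀ᶠ x in 𝓝 t, ∀ b : ℝ, x = μ + b • (t - μ) → ψ x = μ := by
  simp only [cutLocus, mem_ofPred_eq, not_or, not_not, not_exists, not_and] at ht
  have huniq : ∀ z, IsNearestPoint M t z → z = μ := fun z hz => ht.1.unique hz hμ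
  obtain ⟨V, Φ, -, hμs, hΦ⟩ := hsm μ hμ.1
  have hnd := ht.2 μ hμ
  obtain ⟨ψ, hψd, hψ⟩ := exists_critical_point_function hΦ hμs hμ hnd
  refine ⟨ψ, hψd, ?_, ?_⟩
  · have hev := hψ.and (eventually_not_degenerateHessianAt hΦ hμs hnd)
    rw [nhds_prod_eq] at hev
    obtain ⟨A, hA, B, hB, hAB⟩ := Filter.eventually_prod_iff.1 hev
    filter_upwards [hA, hM.eventually_isNearestPoint_mem hμ huniq
      (inter_mem hB (Φ.open_source.mem_nhds hμs))] with x hxA hxB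
    have key : ∀ z, IsNearestPoint M x z → z = ψ x := fun z hz =>
      (hAB hxA (hxB z hz).1).1 hz.1 fun w hw => hz.fderiv_eq_zero hΦ (hxB z hz).2 hw
    refine ⟨?_, key⟩
    rintro (h | ⟨z, hz, hdeg⟩)
    · obtain ⟨z, hz⟩ := hM.exists_isNearestPoint ⟨μ, hμ.1⟩ x
      exact h ⟨z, hz, fun w hw => (key w hw).trans (key z hz).symm⟩
    · exact (hAB hxA (hxB z hz).1).2 hz hdeg
  · have htend : Tendsto (fun x => (x, μ)) (𝓝 t) (𝓝 (t, μ)) :=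
      (continuous_id.prodMk continuous_const).tendsto t
    filter_upwards [htend.eventually hψ] with x hx b hb
    refine (hx hμ.1 fun w hw => ?_).symm
    have h0 := hμ.fderiv_eq_zero hΦ hμs hw
    have hy : Φ μ ∈ Φ.target := Φ.map_source hμs
    rw [fderiv_sqDistTo_apply hΦ _ hy, Φ.left_inv hμs] at h0 ⊢
    have h1 : μ - x = b • (μ - t) := by rw [hb, smul_sub, smul_sub]; abel
    rw [h1, inner_smul_left]
    simp only [conj_trivial]
    linear_combination b * h0

theorem exists_isNearestPoint_of_notMem_cutLocus {M : Set E} {t : E} (ht : t ∉ cutLocus M) :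
    ∃ μ, IsNearestPoint M t μ := by
  simp only [cutLocus, mem_ofPred_eq, not_or, not_not] at ht
  exact ht.1.exists

theorem isClosed_cutLocus [FiniteDimensional ℝ E] {m : ℕ} {M : Set E} (hM : IsCompact M)
    (hsm : IsSmoothSubmanifold m M) : IsClosed (cutLocus M) := by
  rw [← isOpen_compl_iff, isOpen_iff_mem_nhds]
  intro t ht
  obtain ⟨μ, hμ⟩ := exists_isNearestPoint_of_notMem_cutLocus ht
  obtain ⟨ψ, -, h, -⟩ := exists_local_projection hM hsm ht hμ
  exact h.mono fun x hx => hx.1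

theorem differentiableAt_nearestPointMap [FiniteDimensional ℝ E] {m : ℕ} {M : Set E}
    (hM : IsCompact M) (hsm : IsSmoothSubmanifold m M) {t : E} (ht : t ∉ cutLocus M) :
    DifferentiableAt ℝ (nearestPointMap M) t := by
  obtain ⟨μ, hμ⟩ := exists_isNearestPoint_of_notMem_cutLocus ht
  obtain ⟨ψ, hψ, h, -⟩ := exists_local_projection hM hsm ht hμ
  refine hψ.congr_of_eventuallyEq ?_
  filter_upwards [h] with x hx
  obtain ⟨z, hz⟩ := exists_isNearestPoint_of_notMem_cutLocus hx.1
  exact hx.2 _ (nearestPointMap_spec hz)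

/-- The nearest point does not change along a normal ray which does not meet the cutlocus. -/
theorem IsNearestPoint.ray [FiniteDimensional ℝ E] {m : ℕ} {M : Set E} (hM : IsCompact M)
    (hsm : IsSmoothSubmanifold m M) {t μ : E} (hμ : IsNearestPoint M t μ) {b : ℝ} (hb : 1 ≤ b)
    (hC : ∀ s ∈ Icc 1 b, μ + s • (t - μ) ∉ cutLocus M) :
    IsNearestPoint M (μ + b • (t - μ)) μ := by
  set S : Set ℝ := {s | IsNearestPoint M (μ + s • (t - μ)) μ} with hS
  suffices Icc 1 b ⊆ S from this ⟨hb, le_rfl⟩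
  have hclosed : IsClosed S := by
    have : S = ⋂ q ∈ M, {s : ℝ | 2 * s * ⟪t - μ, q - μ⟫ ≤ ‖q - μ‖ ^ 2} := by
      ext s
      simp [hS, isNearestPoint_ray_iff, hμ.1]
    rw [this]
    exact isClosed_biInter fun q _ => isClosed_le (by fun_prop) continuous_const
  refine IsClosed.Icc_subset_of_forall_mem_nhdsWithin (hclosed.inter isClosed_Icc) ?_ ?_
  · simpa [hS] using hμ
  · intro s hs
    have hs1 : (1 : ℝ) ≤ s := hs.2.1
    obtain ⟨ψ, -, h1, h2⟩ := exists_local_projection hM hsm (hC s ⟨hs1, hs.2.2.le⟩) hs.1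
    have hcont : Tendsto (fun r : ℝ => μ + r • (t - μ)) (𝓝 s) (𝓝 (μ + s • (t - μ))) :=
      Continuous.tendsto (by fun_prop) s
    refine mem_nhdsWithin_of_mem_nhds ?_
    filter_upwards [hcont.eventually h1, hcont.eventually h2] with r hr1 hr2
    obtain ⟨z, hz⟩ := exists_isNearestPoint_of_notMem_cutLocus hr1.1
    have hψ := hr2 (r / s) (by
      rw [add_sub_cancel_left, smul_smul, div_mul_cancel₀ r (by linarith)])
    have : z = μ := (hr1.2 z hz).trans hψ
    rwa [this] at hz

/-- If the nearest points of `x` and `y` persist along the normal rays up to the factor `b`, then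
the nearest point map satisfies a Lipschitz bound with constant `b / (b - 1)`. -/
theorem norm_sub_le_of_isNearestPoint_ray {M : Set E} {x y p q : E} {b : ℝ} (hb : 1 < b)
    (hp : IsNearestPoint M (p + b • (x - p)) p) (hq : IsNearestPoint M (q + b • (y - q)) q) :
    ‖p - q‖ ≤ (1 + 1 / (b - 1)) * ‖x - y‖ := by
  rw [isNearestPoint_ray_iff] at hp hq
  have h1 := hp.2 q hq.1
  have h2 := hq.2 p hp.1
  have h3 : ⟪x - p, q - p⟫ + ⟪y - q, p - q⟫ = ‖p - q‖ ^ 2 - ⟪x - y, p - q⟫ := by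
    rw [← real_inner_self_eq_norm_sq]
    simp only [inner_sub_left, inner_sub_right]
    ring
  have h4 := real_inner_le_norm (x - y) (p - q)
  rw [norm_sub_rev q p] at h1
  have h5 : (b - 1) * ‖p - q‖ ^ 2 ≤ b * (‖x - y‖ * ‖p - q‖) := by nlinarith
  have h6 : (b - 1) * ‖p - q‖ ≤ b * ‖x - y‖ := by
    rcases (norm_nonneg (p - q)).eq_or_lt with h0 | h0
    · rw [← h0, mul_zero]; positivity
    · refine le_of_mul_le_mul_right ?_ h0
      nlinarith
  have hb' : 0 < b - 1 := by linarith
  have h7 : (1 + 1 / (b - 1)) * ‖x - y‖ = b * ‖x - y‖ / (b - 1) := by field_simp; ring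
  rw [h7, le_div_iff₀ hb']
  linarith

theorem norm_fderiv_nearestPointMap_le_of_ray [FiniteDimensional ℝ E] {m : ℕ} {M : Set E}
    (hM : IsCompact M) (hsm : IsSmoothSubmanifold m M) {t : E} (ht : t ∉ cutLocus M) {b : ℝ}
    (hb : 1 < b) (hbC : (cutLocus M).Nonempty →
      (b - 1) * Metric.infDist t M < Metric.infDist t (cutLocus M)) :
    ‖fderiv ℝ (nearestPointMap M) t‖ ≤ 1 + 1 / (b - 1) := by
  have hb' : 0 < b - 1 := by linarith
  have hev : ∀ᶠ x in 𝓝 t, (cutLocus M).Nonempty →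
      (b - 1) * Metric.infDist x M < Metric.infDist x (cutLocus M) := by
    by_cases hne : (cutLocus M).Nonempty
    · have h := ((continuous_const.mul (Metric.continuous_infDist_pt M)).tendsto t).eventually_lt
        ((Metric.continuous_infDist_pt (cutLocus M)).tendsto t) (hbC hne)
      exact h.mono fun x hx _ => hx
    · exact Eventually.of_forall fun x h => absurd h hne
  have hnhds : ∀ᶠ x in 𝓝 t, x ∉ cutLocus M :=
    (isClosed_cutLocus hM hsm).isOpen_compl.mem_nhds ht
  have hray : ∀ x, x ∉ cutLocus M → ((cutLocus M).Nonempty →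
      (b - 1) * Metric.infDist x M < Metric.infDist x (cutLocus M)) →
      IsNearestPoint M
        (nearestPointMap M x + b • (x - nearestPointMap M x)) (nearestPointMap M x) := by
    intro x hx hxb
    obtain ⟨z, hz⟩ := exists_isNearestPoint_of_notMem_cutLocus hx
    have hπ := nearestPointMap_spec hz
    set π := nearestPointMap M x
    refine hπ.ray hM hsm hb.le fun s hs hmem => ?_
    have h1 := hxb ⟨_, hmem⟩
    have h2 := Metric.infDist_le_dist_of_mem (x := x) hmem
    rw [hπ.infDist_eq] at h1
    have h3 : x - (π + s • (x - π)) = -((s - 1) • (x - π)) := by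
      rw [sub_smul, one_smul]; abel
    rw [dist_eq_norm, h3, norm_neg, norm_smul, Real.norm_of_nonneg (by linarith [hs.1])] at h2
    have h4 : (s - 1) * ‖x - π‖ ≤ (b - 1) * ‖x - π‖ :=
      mul_le_mul_of_nonneg_right (by linarith [hs.2]) (norm_nonneg _)
    linarith
  refine norm_fderiv_le_of_lip' ℝ (by positivity) ?_
  filter_upwards [hev, hnhds] with x hx hxC
  exact norm_sub_le_of_isNearestPoint_ray hb (hray x hxC hx) (hray t ht hbC)

theorem infDist_cutLocus_pos [FiniteDimensional ℝ E] {m : ℕ} {M : Set E} (hM : IsCompact M)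
    (hsm : IsSmoothSubmanifold m M) {t : E} (ht : t ∉ cutLocus M) (hne : (cutLocus M).Nonempty) :
    0 < Metric.infDist t (cutLocus M) :=
  ((isClosed_cutLocus hM hsm).notMem_iff_infDist_pos hne).1 ht

theorem norm_fderiv_nearestPointMap_le [FiniteDimensional ℝ E] {m : ℕ} {M : Set E}
    (hM : IsCompact M) (hsm : IsSmoothSubmanifold m M) {t : E} (ht : t ∉ cutLocus M) :
    ‖fderiv ℝ (nearestPointMap M) t‖ ≤
      Metric.infDist t M / Metric.infDist t (cutLocus M) + 1 := by
  have hdM : 0 ≤ Metric.infDist t M := Metric.infDist_nonneg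
  have hquot : 0 ≤ Metric.infDist t M / Metric.infDist t (cutLocus M) :=
    div_nonneg hdM Metric.infDist_nonneg
  refine le_of_forall_pos_le_add fun ε hε => ?_
  set c := Metric.infDist t M / Metric.infDist t (cutLocus M) + ε with hc
  have hcpos : 0 < c := by linarith
  have h := norm_fderiv_nearestPointMap_le_of_ray hM hsm ht (b := 1 + 1 / c)
    (by linarith [one_div_pos.2 hcpos]) ?_
  · rw [add_sub_cancel_left, one_div_one_div] at h
    linarith
  · intro hne
    have hpos := infDist_cutLocus_pos hM hsm ht hne
    rw [add_sub_cancel_left, one_div, inv_mul_lt_iff₀ hcpos, hc, add_mul, div_mul_cancel₀ _ hpos.ne']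
    linarith [mul_pos hε hpos]

end CutLocus

section Sphere

variable {E : Type*} [NormedAddCommGroup E] [InnerProductSpace ℝ E]

theorem norm_inv_norm_smul_self {x : E} (hx : x ≠ 0) : ‖‖x‖⁻¹ • x‖ = 1 := by
  rw [norm_smul, norm_inv, norm_norm, inv_mul_cancel₀ (norm_ne_zero_iff.2 hx)]

theorem norm_smul_inv_norm_smul_self {x : E} (hx : x ≠ 0) : ‖x‖ • ‖x‖⁻¹ • x = x := by
  rw [smul_smul, mul_inv_cancel₀ (norm_ne_zero_iff.2 hx), one_smul]

/-- The distance from `x` on the unit sphere grows quadratically away from `x / ‖x‖`. -/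
theorem sqDistTo_eq_add_of_norm_eq_one {x z : E} (hx : x ≠ 0) (hz : ‖z‖ = 1) :
    sqDistTo x z = sqDistTo x (‖x‖⁻¹ • x) + ‖x‖ * ‖z - ‖x‖⁻¹ • x‖ ^ 2 := by
  have hp := norm_inv_norm_smul_self hx
  have hxp := norm_smul_inv_norm_smul_self hx
  set p := ‖x‖⁻¹ • x
  set r := ‖x‖
  simp only [sqDistTo]
  rw [← hxp]
  simp only [norm_sub_sq_real, inner_smul_right, norm_smul, real_inner_self_eq_norm_sq, hp, hz,
    Real.norm_eq_abs, mul_one, sq_abs]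
  ring

theorem isNearestPoint_sphere_iff {x z : E} (hx : x ≠ 0) :
    IsNearestPoint (Metric.sphere 0 1) x z ↔ z = ‖x‖⁻¹ • x := by
  have hp : ‖x‖⁻¹ • x ∈ Metric.sphere (0 : E) 1 := by simpa using norm_inv_norm_smul_self hx
  have hr : 0 < ‖x‖ := norm_pos_iff.2 hx
  constructor
  · rintro ⟨hz, hmin⟩
    have h := hmin _ hp
    rw [sqDistTo_eq_add_of_norm_eq_one hx (by simpa using hz)] at h
    have h0 : ‖z - ‖x‖⁻¹ • x‖ ^ 2 ≤ 0 := by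
      by_contra! hc
      linarith [mul_pos hr hc]
    have h1 : ‖z - ‖x‖⁻¹ • x‖ = 0 := by
      have := sq_nonneg ‖z - ‖x‖⁻¹ • x‖
      exact pow_eq_zero_iff two_ne_zero |>.1 (le_antisymm h0 this)
    exact sub_eq_zero.1 (norm_eq_zero.1 h1)
  · rintro rfl
    refine ⟨hp, fun w hw => ?_⟩
    rw [sqDistTo_eq_add_of_norm_eq_one hx (z := w) (by simpa using hw)]
    have : 0 ≤ ‖x‖ * ‖w - ‖x‖⁻¹ • x‖ ^ 2 := by positivity
    linarith

theorem nearestPointMap_sphere {x : E} (hx : x ≠ 0) :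
    nearestPointMap (Metric.sphere 0 1) x = ‖x‖⁻¹ • x :=
  (isNearestPoint_sphere_iff hx).1 (nearestPointMap_spec ((isNearestPoint_sphere_iff hx).2 rfl))

/-- Images of the model space under a slice chart of the unit sphere are tangent to the sphere. -/
theorem inner_fderiv_symm_eq_zero_of_sphere {V : Submodule ℝ E} {Φ : OpenPartialHomeomorph E E}
    (hΦ : IsSliceChart (Metric.sphere (0 : E) 1) V Φ) {y w : E} (hy : y ∈ Φ.target) (hyV : y ∈ V)
    (hw : w ∈ V) : ⟪Φ.symm y, fderiv ℝ Φ.symm y w⟫ = 0 := by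
  have h := fderiv_apply_eq_of_eventually_eq (V := V) (y := y) (v := w)
    (f := fun y => sqDistTo 0 (Φ.symm y)) (g := fun _ => (1 : ℝ))
    ((contDiffAt_sqDistTo hΦ 0 hy).differentiableAt (by simp)) (differentiableAt_const _) ?_ hyV hw
  · rw [fderiv_sqDistTo_apply hΦ 0 hy] at h
    simpa using h
  · filter_upwards [Φ.open_target.mem_nhds hy] with z hz hzV
    have := (hΦ.isImage.symm_apply_mem_iff hz).2 hzV
    simp only [mem_sphere_iff_norm, sub_zero] at this
    simp [sqDistTo, this]

theorem not_degenerateHessianAt_sphere {x : E} (hx : x ≠ 0) :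
    ¬ DegenerateHessianAt (Metric.sphere 0 1) x (‖x‖⁻¹ • x) := by
  rintro ⟨V, Φ, hΦ, hμ, v, hv, hv0, hker⟩
  have hp : ‖x‖⁻¹ • x ∈ Metric.sphere (0 : E) 1 := by simpa using norm_inv_norm_smul_self hx
  have hr : 0 < ‖x‖ := norm_pos_iff.2 hx
  have hxp := norm_smul_inv_norm_smul_self hx
  set p := ‖x‖⁻¹ • x with hpdef
  set r := ‖x‖
  have hy : Φ p ∈ Φ.target := Φ.map_source hμ
  have hyV : Φ p ∈ V := (hΦ.isImage hμ).2 hp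
  have hsymm : ContDiffAt ℝ ∞ Φ.symm (Φ p) :=
    hΦ.contDiffOn_symm.contDiffAt (Φ.open_target.mem_nhds hy)
  have hd₁ : DifferentiableAt ℝ (fderiv ℝ fun y => sqDistTo x (Φ.symm y)) (Φ p) :=
    ((contDiffAt_sqDistTo hΦ x hy).fderiv_right (m := ∞) (by simp)).differentiableAt (by simp)
  have hA : DifferentiableAt ℝ (fun y => fderiv ℝ Φ.symm y v) (Φ p) :=
    ((hsymm.fderiv_right (m := ∞) (by simp)).differentiableAt (by simp)).clm_apply
      (differentiableAt_const v)
  have hB : DifferentiableAt ℝ (fun y => Φ.symm y - p) (Φ p) :=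
    (hsymm.differentiableAt (by simp)).sub_const p
  have heq := fderiv_apply_eq_of_eventually_eq (V := V) (y := Φ p) (v := v)
    (f := fun y => fderiv ℝ (fun y => sqDistTo x (Φ.symm y)) y v)
    (g := fun y => 2 * r * ⟪Φ.symm y - p, fderiv ℝ Φ.symm y v⟫)
    (hd₁.clm_apply (differentiableAt_const v)) ((hB.inner ℝ hA).const_mul _) ?_ hyV hv
  · have h1 : fderiv ℝ (fun y => fderiv ℝ (fun y => sqDistTo x (Φ.symm y)) y v) (Φ p) v = 0 := by
      rw [fderiv_clm_apply hd₁ (differentiableAt_const v)]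
      simpa using hker v hv
    rw [h1, fderiv_const_mul (hB.inner ℝ hA), smul_apply,
      fderiv_inner_apply ℝ hB hA, Φ.left_inv hμ, sub_self, inner_zero_left, zero_add,
      fderiv_sub_const, real_inner_self_eq_norm_sq, smul_eq_mul, eq_comm] at heq
    have h2 : fderiv ℝ Φ.symm (Φ p) v = 0 := by
      have : ‖fderiv ℝ Φ.symm (Φ p) v‖ ^ 2 = 0 :=
        (mul_eq_zero.1 heq).resolve_left (by positivity)
      exact norm_eq_zero.1 (pow_eq_zero_iff two_ne_zero |>.1 this)
    have hdΦ : HasFDerivAt Φ (fderiv ℝ Φ p) (Φ.symm (Φ p)) := by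
      rw [Φ.left_inv hμ]
      exact ((hΦ.contDiffOn.contDiffAt (Φ.open_source.mem_nhds hμ)).differentiableAt
        (by simp)).hasFDerivAt
    have hcomp := hdΦ.comp (Φ p) (hsymm.differentiableAt (by simp)).hasFDerivAt
    have hid : Φ ∘ Φ.symm =ᶠ[𝓝 (Φ p)] id := by
      filter_upwards [Φ.open_target.mem_nhds hy] with z hz using Φ.right_inv hz
    have := DFunLike.congr_fun
      ((hcomp.congr_of_eventuallyEq hid.symm).unique (hasFDerivAt_id (Φ p))) v
    simp only [ContinuousLinearMap.comp_apply, h2, map_zero, ContinuousLinearMap.id_apply] at this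
    exact hv0 this.symm
  · filter_upwards [Φ.open_target.mem_nhds hy] with z hz hzV
    have htan := inner_fderiv_symm_eq_zero_of_sphere hΦ hz hzV hv
    rw [fderiv_sqDistTo_apply hΦ x hz, inner_sub_left, inner_sub_left, htan, ← hxp,
      inner_smul_left]
    simp only [conj_trivial]
    ring

theorem cutLocus_sphere [Nontrivial E] : cutLocus (Metric.sphere (0 : E) 1) = {0} := by
  ext x
  simp only [mem_singleton_iff]
  constructor
  · intro h
    by_contra hx
    rcases h with h | ⟨μ, hμ, hdeg⟩
    · exact h ⟨_, (isNearestPoint_sphere_iff hx).2 rfl, fun z hz =>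
        (isNearestPoint_sphere_iff hx).1 hz⟩
    · rw [(isNearestPoint_sphere_iff hx).1 hμ] at hdeg
      exact not_degenerateHessianAt_sphere hx hdeg
  · rintro rfl
    refine Or.inl fun ⟨z, hz, huniq⟩ => ?_
    have hzn : ‖z‖ = 1 := by simpa using hz.1
    have hneg : IsNearestPoint (Metric.sphere (0 : E) 1) 0 (-z) :=
      ⟨by simpa using hzn, fun w hw => by
        have hw' : ‖w‖ = 1 := by simpa using hw
        simp [sqDistTo, hzn, hw']⟩
    have h0 : z = 0 := by
      have h2 : (2 : ℝ) • z = 0 := by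
        rw [two_smul]
        nth_rw 1 [← (huniq _ hneg : -z = z)]
        exact neg_add_cancel z
      exact (smul_eq_zero.1 h2).resolve_left two_ne_zero
    simp [h0] at hzn

theorem infDist_sphere_eq {t : E} (ht0 : t ≠ 0) (ht : ‖t‖ ≤ 1) :
    Metric.infDist t (Metric.sphere 0 1) = 1 - ‖t‖ := by
  have h := ((isNearestPoint_sphere_iff ht0).2 rfl).infDist_eq
  have hr : 0 < ‖t‖ := norm_pos_iff.2 ht0
  rw [h]
  have h1 : t - ‖t‖⁻¹ • t = (1 - ‖t‖⁻¹) • t := by rw [sub_smul, one_smul]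
  have h2 : 1 ≤ ‖t‖⁻¹ := (one_le_inv₀ hr).2 ht
  rw [h1, norm_smul, Real.norm_of_nonpos (by linarith)]
  field_simp
  ring

theorem hasFDerivAt_inv_norm_smul {t : E} (ht : t ≠ 0) :
    HasFDerivAt (fun x : E => ‖x‖⁻¹ • x)
      (‖t‖⁻¹ • (ContinuousLinearMap.id ℝ E -
        (innerSL ℝ (‖t‖⁻¹ • t)).smulRight (‖t‖⁻¹ • t))) t := by
  have hr : ‖t‖ ≠ 0 := norm_ne_zero_iff.2 ht
  have h1 : HasFDerivAt (fun x : E => ‖x‖ ^ 2) (2 • innerSL ℝ t) t := (hasFDerivAt_id t).norm_sq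
  have h2 := h1.sqrt (by positivity)
  have h3 : HasFDerivAt (fun x : E => ‖x‖) (‖t‖⁻¹ • innerSL ℝ t) t := by
    have hf : (fun x : E => √(‖x‖ ^ 2)) = fun x => ‖x‖ :=
      funext fun x => Real.sqrt_sq (norm_nonneg x)
    rw [hf, Real.sqrt_sq (norm_nonneg t)] at h2
    convert h2 using 1
    ext w
    simp
    field_simp
  have h4 := ((hasDerivAt_inv hr).comp_hasFDerivAt t h3).smul (hasFDerivAt_id t)
  refine h4.congr_fderiv ?_
  ext w
  simp only [smul_apply, sub_apply, add_apply, ContinuousLinearMap.smulRight_apply,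
    ContinuousLinearMap.id_apply, innerSL_apply_apply, inner_smul_left, conj_trivial, smul_eq_mul,
    id, Function.comp_apply]
  match_scalars <;> field_simp

theorem norm_fderiv_nearestPointMap_sphere {t : E} (ht : t ≠ 0) (hdim : ∃ v : E, v ≠ 0 ∧ ⟪t, v⟫ = 0) :
    DifferentiableAt ℝ (nearestPointMap (Metric.sphere (0 : E) 1)) t ∧
      ‖fderiv ℝ (nearestPointMap (Metric.sphere (0 : E) 1)) t‖ = ‖t‖⁻¹ := by
  have hev : nearestPointMap (Metric.sphere (0 : E) 1) =ᶠ[𝓝 t] fun x => ‖x‖⁻¹ • x := by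
    filter_upwards [isOpen_ne.mem_nhds ht] with x hx using nearestPointMap_sphere hx
  have hd := (hasFDerivAt_inv_norm_smul ht).congr_of_eventuallyEq hev
  refine ⟨hd.differentiableAt, ?_⟩
  rw [hd.fderiv]
  have hp := norm_inv_norm_smul_self ht
  have hr : 0 < ‖t‖ := norm_pos_iff.2 ht
  refine le_antisymm ?_ ?_
  · rw [norm_smul, norm_inv, norm_norm]
    refine mul_le_of_le_one_right (by positivity) ?_
    refine ContinuousLinearMap.opNorm_le_bound _ zero_le_one fun w => ?_
    rw [one_mul]
    refine (sq_le_sq₀ (norm_nonneg _) (norm_nonneg w)).1 ?_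
    simp only [sub_apply, ContinuousLinearMap.id_apply,
      ContinuousLinearMap.smulRight_apply, innerSL_apply_apply]
    rw [norm_sub_sq_real, inner_smul_right, norm_smul, mul_pow, hp, real_inner_comm w,
      Real.norm_eq_abs, sq_abs]
    nlinarith [sq_nonneg ⟪‖t‖⁻¹ • t, w⟫]
  · obtain ⟨v, hv, horth⟩ := hdim
    have hv' : 0 < ‖v‖ := norm_pos_iff.2 hv
    refine le_of_mul_le_mul_right ?_ hv'
    refine le_trans (le_of_eq ?_) (ContinuousLinearMap.le_opNorm _ v)
    simp [horth, norm_smul]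

end Sphere

theorem lemma3p1 :
    (∀ (s m : ℕ) (M : Set (EuclideanSpace ℝ (Fin s))),
      IsCompact M → IsSmoothSubmanifold m M →
      ∀ t : EuclideanSpace ℝ (Fin s), t ∉ cutLocus M →
        ((cutLocus M).Nonempty → 0 < Metric.infDist t (cutLocus M)) ∧
        DifferentiableAt ℝ (nearestPointMap M) t ∧
        ‖fderiv ℝ (nearestPointMap M) t‖ ≤
          Metric.infDist t M / Metric.infDist t (cutLocus M) + 1) ∧
    (∀ (m : ℕ), 1 ≤ m →
      ∀ M : Set (EuclideanSpace ℝ (Fin (m + 1))), M = Metric.sphere 0 1 →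
      ∀ t ∈ Metric.closedBall (0 : EuclideanSpace ℝ (Fin (m + 1))) 1, t ∉ cutLocus M →
        DifferentiableAt ℝ (nearestPointMap M) t ∧
        ‖fderiv ℝ (nearestPointMap M) t‖ =
          Metric.infDist t M / Metric.infDist t (cutLocus M) + 1) := by
  refine ⟨fun s m M hM hsm t ht => ⟨infDist_cutLocus_pos hM hsm ht,
    differentiableAt_nearestPointMap hM hsm ht, norm_fderiv_nearestPointMap_le hM hsm ht⟩, ?_⟩
  rintro m hm M rfl t ht htC
  rw [cutLocus_sphere] at htC ⊢
  have ht0 : t ≠ 0 := htC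
  have ht1 : ‖t‖ ≤ 1 := by simpa using ht
  have hr : 0 < ‖t‖ := norm_pos_iff.2 ht0
  have horth : ∃ v, v ≠ 0 ∧ ⟪t, v⟫ = 0 := by
    have hne : (ℝ ∙ t)ᗮ ≠ ⊥ := by
      intro h
      have h1 := Submodule.finrank_add_finrank_orthogonal (ℝ ∙ t)
      rw [h, finrank_bot, finrank_span_singleton ht0, finrank_euclideanSpace_fin] at h1
      omega
    obtain ⟨v, hv, hv0⟩ := Submodule.exists_mem_ne_zero_of_ne_bot hne
    exact ⟨v, hv0, Submodule.mem_orthogonal_singleton_iff_inner_right.1 hv⟩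
  obtain ⟨hd, hn⟩ := norm_fderiv_nearestPointMap_sphere ht0 horth
  refine ⟨hd, ?_⟩
  rw [hn, infDist_sphere_eq ht0 ht1, Metric.infDist_singleton, dist_zero_right]
  field_simp
  ring
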